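/- Work in ZFC. A p-point is a nonprincipal ultrafilter $\mathcal U$ on a countably infinite set such that for every sequence $(X_n)_{n<\omega}$ of members of $\mathcal U$ there is $X\in\mathcal U$ with $X\setminus X_n$ finite for all $n$. Ultrafilters are partially ordered by reverse inclusion, and $\mathcal V\le_T\mathcal U$ means that there is a map $\mathcal U\to\mathcal V$ which sends every cofinal subset of $\mathcal U$ to a cofinal subset of $\mathcal V$; write $\mathcal V<_T\mathcal U$ if $\mathcal V\le_T\mathcal U$ and $\mathcal U\not\le_T\mathcal V$. For an ultrafilter $D$ on $\omega\times\omega$ let $\pi_1(D)=\{A\subseteq\omega: A\times\omega\in D\}$ and $\pi_2(D)=\{A\subseteq\omega:\omega\times A\in D\}$. Theorem. Assume Martin's Axiom (for every nonempty ccc partial order and every family of fewer than $2^{\aleph_0}$ of its dense subsets there is a filter meeting all of them). Then there are a p-point $D$ on $\omega\times\omega$ and a p-point $E$ on $\omega$ such that $\pi_1(D)$ and $\pi_2(D)$ are p-points, $\pi_1(D)\not\le_T\pi_2(D)$, $\pi_2(D)\not\le_T\pi_1(D)$, and $$E<_T\pi_1(D)<_T D,\qquad E<_T\pi_2(D)<_T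 D.$$ Consequently the four-element diamond lattice $\{0,1\}^2$ embeds, as a partial order, into the Tukey types of p-points on $\omega$, by $(1,1)\mapsto[D]$, $(1,0)\mapsto[\pi_1(D)]$, $(0,1)\mapsto[\pi_2(D)]$, $(0,0)\mapsto[E]$, where $D$ is transported to $\omega$ by a bijection $\omega\times\omega\to\omega$. -/

import Mathlib

open scoped Cardinal

namespace TukeyUF

/-! ### Martin's Axiom -/

/-- Two conditions of a forcing poset are compatible if they have a common extension. -/
def Compat {P : Type*} [PartialOrder P] (p q : P) : Prop :=
  ∃ r, r ≤ p ∧ r ≤ q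

/-- The countable chain condition: every set of pairwise incompatible conditions is countable. -/
def CCC (P : Type*) [PartialOrder P] : Prop :=
  ∀ A : Set P, A.Pairwise (fun p q => ¬ Compat p q) → A.Countable

/-- `S` is dense in the forcing poset `P`: every condition has an extension in `S`. -/
def DenseSet {P : Type*} [PartialOrder P] (S : Set P) : Prop :=
  ∀ p : P, ∃ q ∈ S, q ≤ p

/-- Martin's Axiom: for every nonempty ccc poset and every family of fewer than continuum many
dense subsets there is a filter that meets all of them. -/
def MartinsAxiom : Prop :=
  ∀ (P : Type) [PartialOrder P] [Nonempty P], CCC P →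
    ∀ 𝒮 : Set (Set P), #𝒮 < 𝔠 → (∀ S ∈ 𝒮, DenseSet S) →
      ∃ G : Order.PFilter P, ∀ S ∈ 𝒮, ∃ p ∈ G, p ∈ S

/-! ### Tukey reducibility -/

/-- A map between partial orders is cofinal if it sends cofinal sets to cofinal sets. -/
def CofinalMap {E D : Type*} [PartialOrder E] [PartialOrder D] (f : E → D) : Prop :=
  ∀ C : Set E, IsCofinal C → IsCofinal (f '' C)

/-- `TukeyRed D E` says that `D` is Tukey reducible to `E`, i.e. `D ≤_T E`. -/
def TukeyRed (D E : Type*) [PartialOrder D] [PartialOrder E] : Prop :=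
  ∃ f : E → D, CofinalMap f

/-- An ultrafilter as a partial order: its members, ordered by reverse inclusion. -/
abbrev Poset {α : Type*} (U : Ultrafilter α) : Type _ := {s : Set α // s ∈ U}ᵒᵈ

/-- `U ≤_T V` for ultrafilters. -/
def TukeyLE {α β : Type*} (U : Ultrafilter α) (V : Ultrafilter β) : Prop :=
  TukeyRed (Poset U) (Poset V)

/-- `U <_T V` for ultrafilters. -/
def TukeyLT {α β : Type*} (U : Ultrafilter α) (V : Ultrafilter β) : Prop :=
  TukeyLE U V ∧ ¬ TukeyLE V U

/-- Neither `U ≤_T V` nor `V ≤_T U`. -/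
def TukeyIncomparable {α β : Type*} (U : Ultrafilter α) (V : Ultrafilter β) : Prop :=
  ¬ TukeyLE U V ∧ ¬ TukeyLE V U

theorem TukeyLE.refl {α : Type*} (U : Ultrafilter α) : TukeyLE U U :=
  ⟨id, fun C hC => by simpa using hC⟩

theorem TukeyLE.trans {α β γ : Type*} {U : Ultrafilter α} {V : Ultrafilter β} {W : Ultrafilter γ}
    (h₁ : TukeyLE U V) (h₂ : TukeyLE V W) : TukeyLE U W := by
  obtain ⟨f, hf⟩ := h₁
  obtain ⟨g, hg⟩ := h₂
  refine ⟨f ∘ g, fun C hC => ?_⟩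
  rw [Set.image_comp]
  exact hf _ (hg _ hC)

/-! ### P-points -/

/-- A (nonprincipal) p-point: every countable family of members has a pseudo-intersection among
the members. -/
def IsPPoint {α : Type*} (U : Ultrafilter α) : Prop :=
  (∀ a : α, ({a} : Set α) ∉ U) ∧
    ∀ X : ℕ → Set α, (∀ n, X n ∈ U) → ∃ Y ∈ U, ∀ n, (Y \ X n).Finite

theorem IsPPoint.mapEquiv {α β : Type*} {U : Ultrafilter α} (hU : IsPPoint U) (e : α ≃ β) :
    IsPPoint (U.map e) := by
  refine ⟨fun b hb => hU.1 (e.symm b) ?_, fun X hX => ?_⟩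
  · have h : e ⁻¹' {b} ∈ U := hb
    have h' : e ⁻¹' {b} = {e.symm b} := by
      ext x
      simp [Equiv.eq_symm_apply]
    rwa [h'] at h
  · obtain ⟨Y, hY, hf⟩ := hU.2 (fun n => e ⁻¹' X n) hX
    refine ⟨e '' Y, ?_, fun n => ?_⟩
    · change e ⁻¹' (e '' Y) ∈ U
      rwa [Set.preimage_image_eq _ e.injective]
    · refine ((hf n).image e).subset ?_
      rintro _ ⟨⟨y, hy, rfl⟩, hn⟩
      exact ⟨y, ⟨hy, hn⟩, rfl⟩

/-- The p-points on `ω`. -/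
structure PPoint where
  toUltrafilter : Ultrafilter ℕ
  isPPoint : IsPPoint toUltrafilter

/-- The p-points on `ω`, preordered by Tukey reducibility. -/
instance : Preorder PPoint where
  le U V := TukeyLE U.toUltrafilter V.toUltrafilter
  le_refl U := TukeyLE.refl _
  le_trans _ _ _ h₁ h₂ := h₁.trans h₂

/-- The partial order of the Tukey types of p-points on `ω`: p-points modulo `≡_T`. -/
abbrev PPointType : Type := Antisymmetrization PPoint (· ≤ ·)

/-- The Tukey type of a p-point on `ω`. -/
def tukeyType (U : Ultrafilter ℕ) (hU : IsPPoint U) : PPointType :=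
  toAntisymmetrization (· ≤ ·) ⟨U, hU⟩

/-- The first projection of an ultrafilter on `ω × ω`: `A ∈ π₁(D)` iff `A × ω ∈ D`. -/
def proj₁ (D : Ultrafilter (ℕ × ℕ)) : Ultrafilter ℕ := D.map Prod.fst

/-- The second projection of an ultrafilter on `ω × ω`: `A ∈ π₂(D)` iff `ω × A ∈ D`. -/
def proj₂ (D : Ultrafilter (ℕ × ℕ)) : Ultrafilter ℕ := D.map Prod.snd

end TukeyUF

namespace TukeyUF

/-! ### Tukey reductions from p-points are given by finitary relations -/

/-! The ultrafilter `D` is built generically from the sets that contain arbitrarily large finite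
rectangles inside the squares of late blocks, the `n`-th block being the numbers whose first
unpaired coordinate is `n`. By bipartite Ramsey the remaining sets form an ideal, so a tower of
large sets can generate an ultrafilter with only large members. Such an ultrafilter contains the set
of pairs whose coordinates share a block, so both projections have the same image `E` under the
block-number map.

Incomparability of the projections is the core. A Tukey reduction to a p-point on `ω` is induced by
a relation between finite sets and points (`IsPPoint.exists_finitaryWitness`), so there are only
continuum many to defeat. Each is defeated inside any given large set (`LargeRect.exists_avoid`).
Martin's Axiom supplies large pseudo-intersections of shorter towers, which carries the recursion
through continuum many steps (`MartinsAxiom.exists_tower`). All strict inequalities then follow from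
incomparability by transitivity. -/

theorem TukeyLE.map {α β : Type*} (U : Ultrafilter α) (g : α → β) : TukeyLE (U.map g) U := by
  refine ⟨fun a => OrderDual.toDual ⟨g '' (OrderDual.ofDual a).1,
    Filter.image_mem_map (OrderDual.ofDual a).2⟩, fun C hC b => ?_⟩
  obtain ⟨c, hc, hbc⟩ := hC (OrderDual.toDual ⟨g ⁻¹' (OrderDual.ofDual b).1, (OrderDual.ofDual b).2⟩)
  refine ⟨_, ⟨c, hc, rfl⟩, ?_⟩
  change g '' (OrderDual.ofDual c).1 ⊆ (OrderDual.ofDual b).1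
  rw [Set.image_subset_iff]
  exact hbc

theorem IsPPoint.map {α β : Type*} {U : Ultrafilter α} (hU : IsPPoint U) (g : α → β)
    (hg : ∀ b, ({b} : Set β) ∉ U.map g) : IsPPoint (U.map g) := by
  refine ⟨hg, fun X hX => ?_⟩
  obtain ⟨Y, hY, hf⟩ := hU.2 (fun n => g ⁻¹' X n) hX
  refine ⟨g '' Y, Filter.image_mem_map hY, fun n => ((hf n).image g).subset ?_⟩
  rintro _ ⟨⟨y, hy, rfl⟩, hn⟩
  exact ⟨y, ⟨hy, hn⟩, rfl⟩

/-- Send `A` to the union of the values of `f` at members contained in `A`. If no such union were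
inside `B`, the members whose `f`-value is not inside `B` would be cofinal, while their images are
not. -/
theorem TukeyLE.exists_monotone {α β : Type*} {U : Ultrafilter α} {V : Ultrafilter β}
    (h : TukeyLE V U) :
    ∃ φ : Set α → Set β, Monotone φ ∧ (∀ A ∈ U, φ A ∈ V) ∧ ∀ B ∈ V, ∃ A ∈ U, φ A ⊆ B := by
  obtain ⟨f, hf⟩ := h
  refine ⟨fun A => {k | ∃ a : Poset U, (OrderDual.ofDual a).1 ⊆ A ∧ k ∈ (OrderDual.ofDual (f a)).1},
    fun A B hAB k ⟨a, ha, hk⟩ => ⟨a, ha.trans hAB, hk⟩, fun A hA => ?_, fun B hB => ?_⟩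
  · refine Filter.mem_of_superset (OrderDual.ofDual (f (OrderDual.toDual ⟨A, hA⟩))).2 ?_
    exact fun k hk => ⟨OrderDual.toDual ⟨A, hA⟩, subset_rfl, hk⟩
  · by_contra! hcon
    have hC : IsCofinal {a : Poset U | ¬ (OrderDual.ofDual (f a)).1 ⊆ B} := by
      intro a
      obtain ⟨k, ⟨a', ha', hk⟩, hkB⟩ := Set.not_subset.1 (hcon _ (OrderDual.ofDual a).2)
      exact ⟨a', fun hsub => hkB (hsub hk), ha'⟩
    obtain ⟨_, ⟨a, ha, rfl⟩, hle⟩ := hf _ hC (OrderDual.toDual ⟨B, hB⟩)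
    exact ha hle

/-- Given members `Y n` of a p-point, some member `X` satisfies `X \ n ⊆ Y n` for infinitely
many `n`. -/
theorem IsPPoint.exists_gaps {U : Ultrafilter ℕ} (hU : IsPPoint U) (Y : ℕ → Set ℕ)
    (hY : ∀ n, Y n ∈ U) :
    ∃ X ∈ U, ∀ k, ∃ n, k ≤ n ∧ ∀ x ∈ X, n ≤ x → x ∈ Y n := by
  obtain ⟨X, hX, hfin⟩ := hU.2 Y hY
  have hg : ∀ n, ∃ m, n < m ∧ ∀ x ∈ X, m ≤ x → x ∈ Y n := by
    intro n
    obtain ⟨b, hb⟩ := (hfin n).bddAbove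
    refine ⟨max b n + 1, by omega, fun x hx hle => ?_⟩
    by_contra hxY
    have := hb ⟨hx, hxY⟩
    omega
  choose g hlt hg using hg
  set p : ℕ → ℕ := fun i => g^[i] 0 with hp
  have hs : ∀ i, p (i + 1) = g (p i) := fun i => Function.iterate_succ_apply' g i 0
  have hmono : StrictMono p := strictMono_nat_of_lt_succ fun i => by rw [hs]; exact hlt _
  -- Alternate intervals of the partition by `p` form `E`. Whichever of `E`, `Eᶜ` is in `U` skips
  -- every other interval `[n, g n)`, and past `g n` all points of `X` lie in `Y n`.
  set E : Set ℕ := {x | ∃ i, p (2 * i) ≤ x ∧ x < p (2 * i + 1)} with hE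
  rcases U.mem_or_compl_mem E with h | h
  · refine ⟨X ∩ E, Filter.inter_mem hX h, fun k => ⟨p (2 * k + 1), ?_, ?_⟩⟩
    · have := hmono.id_le (2 * k + 1)
      simp only [id] at this
      omega
    · rintro x ⟨hx, i, hi, hi'⟩ hle
      refine hg _ x hx ?_
      rw [← hs]
      have : 2 * k + 1 < 2 * i + 1 := hmono.lt_iff_lt.1 (hle.trans_lt hi')
      exact (hmono.monotone (by omega)).trans hi
  · refine ⟨X ∩ Eᶜ, Filter.inter_mem hX h, fun k => ⟨p (2 * k), ?_, ?_⟩⟩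
    · have := hmono.id_le (2 * k)
      simp only [id] at this
      omega
    · rintro x ⟨hx, hxE⟩ hle
      refine hg _ x hx ?_
      rw [← hs]
      by_contra hlt'
      exact hxE ⟨k, hle, not_le.1 hlt'⟩

/-- Otherwise each finite `s ⊆ A` and each `k` have a counterexample `a s k`. Diagonalise over these
to get `X` with gaps, and take `k ∈ φ (X ∩ A)`. With `s` the part of `X ∩ A` below a gap past the
code of `k`, all of `X ∩ A` lies in `a s k`, so monotonicity puts `k` in `φ (a s k)`. -/
theorem IsPPoint.exists_finite_witness {β : Type*} [Encodable β] {U : Ultrafilter ℕ}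
    (hU : IsPPoint U) {φ : Set ℕ → Set β} (hφ : Monotone φ) (hne : ∀ A ∈ U, (φ A).Nonempty)
    {A : Set ℕ} (hA : A ∈ U) :
    ∃ s : Finset ℕ, (s : Set ℕ) ⊆ A ∧ ∃ k, ∀ a ∈ U, (s : Set ℕ) ⊆ a → k ∈ φ a := by
  by_contra! hcon
  have hcon' : ∀ (s : Finset ℕ) (k : β), ∃ a ∈ U, (s : Set ℕ) ⊆ A → (s : Set ℕ) ⊆ a ∧ k ∉ φ a := by
    intro s k
    by_cases hs : (s : Set ℕ) ⊆ A
    · obtain ⟨a, ha, h⟩ := hcon s hs k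
      exact ⟨a, ha, fun _ => h⟩
    · exact ⟨A, hA, fun h => absurd h hs⟩
  choose a haU ha using hcon'
  let Y : ℕ → Set ℕ := fun n => ⋂ s ∈ (Finset.range n).powerset,
    ⋂ k ∈ {k : β | Encodable.encode k ≤ n}, a s k
  have hY : ∀ n, Y n ∈ U := by
    intro n
    refine (Filter.biInter_finset_mem _).2 fun s _ => (Filter.biInter_mem ?_).2 fun k _ => haU s k
    exact (Set.finite_Iic n).preimage Encodable.encode_injective.injOn
  obtain ⟨X, hX, hgap⟩ := hU.exists_gaps Y hY
  obtain ⟨k, hk⟩ := hne _ (Filter.inter_mem hX hA)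
  obtain ⟨n, hkn, hn⟩ := hgap (Encodable.encode k)
  classical
  let s : Finset ℕ := (Finset.range n).filter (· ∈ X ∩ A)
  have hsA : (s : Set ℕ) ⊆ A := fun x hx => (Finset.mem_filter.1 hx).2.2
  refine (ha s k hsA).2 (hφ ?_ hk)
  intro x hx
  rcases lt_or_ge x n with h | h
  · exact (ha s k hsA).1 (Finset.mem_coe.2 (Finset.mem_filter.2 ⟨Finset.mem_range.2 h, hx⟩))
  · have := hn x hx.1 h
    simp only [Y, Set.mem_iInter] at this
    exact this s (Finset.mem_powerset.2 (Finset.filter_subset _ _)) k hkn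

/-- The monotone map on sets induced by a relation between finite sets and points. -/
def finitaryMap {α β : Type*} (R : Set (Finset α × β)) (A : Set α) : Set β :=
  {k | ∃ s : Finset α, (s : Set α) ⊆ A ∧ (s, k) ∈ R}

theorem finitaryMap_mono {α β : Type*} (R : Set (Finset α × β)) : Monotone (finitaryMap R) :=
  fun _ _ hAB _ ⟨s, hs, hk⟩ => ⟨s, hs.trans hAB, hk⟩

/-- The map induced by `R` witnesses `V ≤_T U`. -/
def FinitaryWitness {α β : Type*} (R : Set (Finset α × β)) (V : Ultrafilter β)
    (U : Ultrafilter α) : Prop :=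
  (∀ A ∈ U, finitaryMap R A ∈ V) ∧ ∀ B ∈ V, ∃ A ∈ U, finitaryMap R A ⊆ B

theorem IsPPoint.exists_finitaryWitness {β : Type*} [Encodable β] {U : Ultrafilter ℕ}
    (hU : IsPPoint U) {V : Ultrafilter β} (h : TukeyLE V U) :
    ∃ R : Set (Finset ℕ × β), FinitaryWitness R V U := by
  obtain ⟨φ, hφ, hV, hcof⟩ := h.exists_monotone
  have hsub : ∀ A ∈ U, finitaryMap {q : Finset ℕ × β | ∀ a ∈ U, (q.1 : Set ℕ) ⊆ a → q.2 ∈ φ a} A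
      ⊆ φ A := fun A hA k ⟨s, hs, hk⟩ => hk A hA hs
  refine ⟨{q | ∀ a ∈ U, (q.1 : Set ℕ) ⊆ a → q.2 ∈ φ a}, fun A hA => ?_, fun B hB => ?_⟩
  -- A witness inside `A ∩ A'` gives a point both in the image of `A` and in `φ A'`, which avoids
  -- that image.
  · by_contra hnot
    obtain ⟨A', hA', hsub'⟩ := hcof _ (Ultrafilter.compl_mem_iff_notMem.2 hnot)
    obtain ⟨s, hs, k, hk⟩ := hU.exists_finite_witness hφ
      (fun A hA => V.nonempty_of_mem (hV A hA)) (Filter.inter_mem hA hA')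
    exact hsub' (hk A' hA' (hs.trans Set.inter_subset_right))
      ⟨s, hs.trans Set.inter_subset_left, hk⟩
  · obtain ⟨A, hA, hAB⟩ := hcof B hB
    exact ⟨A, hA, (hsub A hA).trans hAB⟩

/-! ### The ideal of sets without large rectangles -/

/-- `Z` contains a `k × k` rectangle in the `n`-th block of `ω × ω`. -/
def HasRect (k n : ℕ) (Z : Set (ℕ × ℕ)) : Prop :=
  ∃ S T : Finset ℕ, S.card = k ∧ T.card = k ∧ (∀ a ∈ S, a.unpair.1 = n) ∧
    (∀ b ∈ T, b.unpair.1 = n) ∧ ∀ a ∈ S, ∀ b ∈ T, (a, b) ∈ Z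

/-- `Z` contains arbitrarily large rectangles in arbitrarily late blocks. -/
def LargeRect (Z : Set (ℕ × ℕ)) : Prop :=
  ∀ k, ∃ n, k ≤ n ∧ HasRect k n Z

theorem HasRect.mono {k l n : ℕ} {Z W : Set (ℕ × ℕ)} (h : HasRect l n Z) (hkl : k ≤ l)
    (hZW : Z ⊆ W) : HasRect k n W := by
  obtain ⟨S, T, hS, hT, hSn, hTn, hZ⟩ := h
  obtain ⟨S', hS', hc⟩ := Finset.exists_subset_card_eq (hkl.trans hS.ge)
  obtain ⟨T', hT', hc'⟩ := Finset.exists_subset_card_eq (hkl.trans hT.ge)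
  exact ⟨S', T', hc, hc', fun a ha => hSn a (hS' ha), fun b hb => hTn b (hT' hb),
    fun a ha b hb => hZW (hZ a (hS' ha) b (hT' hb))⟩

theorem LargeRect.mono {Z W : Set (ℕ × ℕ)} (h : LargeRect Z) (hZW : Z ⊆ W) : LargeRect W :=
  fun k => let ⟨n, hn, hr⟩ := h k; ⟨n, hn, hr.mono le_rfl hZW⟩

theorem LargeRect.exists_ge {Z : Set (ℕ × ℕ)} (h : LargeRect Z) (k m : ℕ) :
    ∃ n, m ≤ n ∧ HasRect k n Z := by
  obtain ⟨n, hn, hr⟩ := h (max k m)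
  exact ⟨n, (le_max_right _ _).trans hn, hr.mono (le_max_left _ _) subset_rfl⟩

theorem largeRect_univ : LargeRect Set.univ := by
  intro k
  have hinj : Function.Injective (Nat.pair k) := fun x y h => (Nat.pair_eq_pair.1 h).2
  have hblock : ∀ a ∈ (Finset.range k).image (Nat.pair k), a.unpair.1 = k := by
    intro a ha
    obtain ⟨x, -, rfl⟩ := Finset.mem_image.1 ha
    simp
  refine ⟨k, le_rfl, _, _, ?_, ?_, hblock, hblock, fun _ _ _ _ => Set.mem_univ _⟩ <;>
  rw [Finset.card_image_of_injective _ hinj, Finset.card_range]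

/-- Bipartite Ramsey: a large rectangle split in two contains a square on one side. -/
theorem HasRect.inter_or_diff {k n : ℕ} {Z : Set (ℕ × ℕ)} (W : Set (ℕ × ℕ))
    (h : HasRect (2 ^ (2 * k) * (2 * k)) n Z) : HasRect k n (Z ∩ W) ∨ HasRect k n (Z \ W) := by
  classical
  obtain ⟨S, T, hS, hT, hSn, hTn, hZ⟩ := h
  obtain ⟨S', hS', hc⟩ := Finset.exists_subset_card_eq (s := S) (n := 2 * k)
    (hS ▸ Nat.le_mul_of_pos_left _ (by positivity))
  -- Colour each column by its trace of `W` on the `2 * k` rows `S'`. Among `2 ^ (2 * k)` colours,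
  -- one trace `c` is shared by `k` columns, and `c` or `S' \ c` has at least `k` rows.
  obtain ⟨c, hcS, hcard⟩ := Finset.exists_le_card_fiber_of_mul_le_card_of_maps_to (s := T)
    (t := S'.powerset) (f := fun b => S'.filter fun a => (a, b) ∈ W) (n := k)
    (fun b _ => Finset.mem_powerset.2 (Finset.filter_subset _ _)) ⟨∅, by simp⟩
    (by rw [Finset.card_powerset, hc, hT]; gcongr; omega)
  obtain ⟨T', hT', hTc⟩ := Finset.exists_subset_card_eq hcard
  have hmem : ∀ b ∈ T', b ∈ T ∧ ∀ a ∈ S', a ∈ c ↔ (a, b) ∈ W := by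
    intro b hb
    obtain ⟨hbT, rfl⟩ := Finset.mem_filter.1 (hT' hb)
    exact ⟨hbT, fun a ha => by simp [ha]⟩
  have hsum := Finset.card_sdiff_add_card_eq_card (Finset.mem_powerset.1 hcS)
  rcases le_total k c.card with hk | hk
  · obtain ⟨S'', hS'', hc''⟩ := Finset.exists_subset_card_eq hk
    have hsub := hS''.trans (Finset.mem_powerset.1 hcS)
    exact Or.inl ⟨S'', T', hc'', hTc, fun a ha => hSn a (hS' (hsub ha)),
      fun b hb => hTn b (hmem b hb).1, fun a ha b hb => ⟨hZ a (hS' (hsub ha)) b (hmem b hb).1,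
        ((hmem b hb).2 a (hsub ha)).1 (hS'' ha)⟩⟩
  · obtain ⟨S'', hS'', hc''⟩ := Finset.exists_subset_card_eq (s := S' \ c) (n := k) (by omega)
    have hsub := hS''.trans Finset.sdiff_subset
    exact Or.inr ⟨S'', T', hc'', hTc, fun a ha => hSn a (hS' (hsub ha)),
      fun b hb => hTn b (hmem b hb).1, fun a ha b hb => ⟨hZ a (hS' (hsub ha)) b (hmem b hb).1,
        fun hW => (Finset.mem_sdiff.1 (hS'' ha)).2 (((hmem b hb).2 a (hsub ha)).2 hW)⟩⟩

theorem LargeRect.inter_or_diff {Z : Set (ℕ × ℕ)} (h : LargeRect Z) (W : Set (ℕ × ℕ)) :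
    LargeRect (Z ∩ W) ∨ LargeRect (Z \ W) := by
  by_contra! hcon
  simp only [LargeRect, not_forall, not_exists, not_and] at hcon
  obtain ⟨⟨k, hk⟩, l, hl⟩ := hcon
  obtain ⟨n, hn, hr⟩ := h.exists_ge (2 ^ (2 * max k l) * (2 * max k l)) (max k l)
  rcases hr.inter_or_diff W with hr | hr
  · exact hk n (le_of_max_le_left hn) (hr.mono (le_max_left _ _) subset_rfl)
  · exact hl n (le_of_max_le_right hn) (hr.mono (le_max_right _ _) subset_rfl)

/-- Sets all of whose rectangles lie in a finite number of blocks are small. -/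
theorem not_largeRect_of_bounded {Z : Set (ℕ × ℕ)} (m : ℕ) (h : ∀ q ∈ Z, q.1.unpair.1 < m) :
    ¬ LargeRect Z := by
  intro hZ
  obtain ⟨n, hn, S, T, hS, hT, hSn, -, hr⟩ := hZ.exists_ge 1 m
  obtain ⟨a, ha⟩ := Finset.card_pos.1 (hS ▸ Nat.one_pos)
  obtain ⟨b, hb⟩ := Finset.card_pos.1 (hT ▸ Nat.one_pos)
  have := h _ (hr a ha b hb)
  have := hSn a ha
  simp only at *
  omega

theorem LargeRect.diff_finite {Z F : Set (ℕ × ℕ)} (h : LargeRect Z) (hF : F.Finite) :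
    LargeRect (Z \ F) := by
  refine (h.inter_or_diff F).resolve_left ?_
  obtain ⟨m, hm⟩ := (hF.image fun q => q.1.unpair.1).bddAbove
  exact not_largeRect_of_bounded (m + 1) fun q hq =>
    Nat.lt_succ_of_le (hm ⟨q, hq.2, rfl⟩)

theorem LargeRect.swap {Z : Set (ℕ × ℕ)} (h : LargeRect Z) : LargeRect (Prod.swap ⁻¹' Z) := by
  intro k
  obtain ⟨n, hn, S, T, hS, hT, hSn, hTn, hr⟩ := h k
  exact ⟨n, hn, T, S, hT, hS, hTn, hSn, fun a ha b hb => hr b hb a ha⟩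

/-- A large set contains two large sets whose second projections are disjoint and which have
the same large restrictions to sets of first coordinates. -/
theorem LargeRect.exists_split {Z : Set (ℕ × ℕ)} (h : LargeRect Z) :
    ∃ Z₀ ⊆ Z, ∃ Z₁ ⊆ Z, LargeRect Z₀ ∧ Disjoint (Prod.snd '' Z₀) (Prod.snd '' Z₁) ∧
      ∀ X : Set ℕ, LargeRect (Z₀ ∩ Prod.fst ⁻¹' X) → LargeRect (Z₁ ∩ Prod.fst ⁻¹' X) := by
  -- Pick a `2k × 2k` rectangle in each of a sequence of distinct blocks, then halve its columns:
  -- `T' k` serves `Z₀`, the rest serves `Z₁`.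
  obtain ⟨p, hp, hrect⟩ := Filter.extraction_forall_of_frequently
    (P := fun k n => HasRect (2 * k) n Z) fun k => Filter.frequently_atTop.2 fun m =>
      let ⟨n, hn, hr⟩ := h.exists_ge (2 * k) m; ⟨n, hn, hr⟩
  choose S T hS hT hSn hTn hr using hrect
  have hex : ∀ k, ∃ T' ⊆ T k, T'.card = k := fun k =>
    Finset.exists_subset_card_eq (by rw [hT]; omega)
  choose T' hT' hTc using hex
  have hcard : ∀ k, (T k \ T' k).card = k := by
    intro k
    have := Finset.card_sdiff_add_card_eq_card (hT' k)
    rw [hT, hTc] at this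
    omega
  refine ⟨{q | ∃ k, q.1 ∈ S k ∧ q.2 ∈ T' k}, ?_, {q | ∃ k, q.1 ∈ S k ∧ q.2 ∈ T k \ T' k}, ?_, ?_,
    ?_, ?_⟩
  · rintro ⟨a, b⟩ ⟨k, ha, hb⟩
    exact hr k a ha b (hT' k hb)
  · rintro ⟨a, b⟩ ⟨k, ha, hb⟩
    exact hr k a ha b (Finset.mem_sdiff.1 hb).1
  · intro k
    obtain ⟨S', hS', hc⟩ := Finset.exists_subset_card_eq (s := S k) (n := k) (by rw [hS]; omega)
    exact ⟨p k, hp.id_le k, S', T' k, hc, hTc k, fun a ha => hSn k a (hS' ha),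
      fun b hb => hTn k b (hT' k hb), fun a ha b hb => ⟨k, hS' ha, hb⟩⟩
  · rw [Set.disjoint_left]
    rintro _ ⟨⟨a, b⟩, ⟨k, -, hb⟩, rfl⟩ ⟨⟨a', b'⟩, ⟨l, -, hb'⟩, hbb⟩
    simp only at hb hb' hbb
    subst hbb
    rw [Finset.mem_sdiff] at hb'
    have hkl : k = l := hp.injective ((hTn k _ (hT' k hb)).symm.trans (hTn l _ hb'.1))
    subst hkl
    exact hb'.2 hb
  · intro X hX k
    -- Size `k + 1` makes the rectangle nonempty, which locates it in a single chosen block `p j`.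
    -- Its rows `U` also work for `Z₁`, and its columns lie in `T' j`, so `k + 1 ≤ j` and the other
    -- half of `T j` has enough columns.
    obtain ⟨n, hn, U, V, hU, hV, hUn, hVn, hUV⟩ := hX (k + 1)
    obtain ⟨a₀, ha₀⟩ := Finset.card_pos.1 (by rw [hU]; omega)
    obtain ⟨b₀, hb₀⟩ := Finset.card_pos.1 (by rw [hV]; omega)
    obtain ⟨⟨j, hj, -⟩, -⟩ := hUV a₀ ha₀ b₀ hb₀
    have hnj : n = p j := (hUn a₀ ha₀).symm.trans (hSn j _ hj)
    have hmem : ∀ a ∈ U, ∀ b ∈ V, (a ∈ S j ∧ b ∈ T' j) ∧ a ∈ X := by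
      intro a ha b hb
      obtain ⟨⟨l, hl, hl'⟩, haX⟩ := hUV a ha b hb
      have : l = j := hp.injective ((hSn l _ hl).symm.trans ((hUn a ha).trans hnj))
      subst this
      exact ⟨⟨hl, hl'⟩, haX⟩
    have hkj : k + 1 ≤ j := by
      rw [← hV, ← hTc j]
      exact Finset.card_le_card fun b hb => (hmem a₀ ha₀ b hb).1.2
    have : HasRect (k + 1) n ({q | ∃ k, q.1 ∈ S k ∧ q.2 ∈ T k \ T' k} ∩ Prod.fst ⁻¹' X) := by
      obtain ⟨V', hV', hc⟩ := Finset.exists_subset_card_eq (hkj.trans (hcard j).ge)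
      exact ⟨U, V', hU, hc, hUn,
        fun b hb => hnj ▸ hTn j b (Finset.mem_sdiff.1 (hV' hb)).1, fun a ha b hb =>
          ⟨⟨j, (hmem a ha b₀ hb₀).1.1, hV' hb⟩, (hmem a ha b₀ hb₀).2⟩⟩
    exact ⟨n, by omega, this.mono k.le_succ subset_rfl⟩

/-! ### Avoiding a finitary reduction -/

/-- If some large `Z' ⊆ Z` has second projection disjoint from the `R`-image of its first, that `Z'`
refutes `R`. Otherwise split `Z` and choose `Z₀`. If `R` worked, some `X` in `proj₁ D` would have
its `R`-image inside the second projection of `Z₀`. Then `Z₁` restricted to `X` is large and has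
exactly the excluded disjointness. -/
theorem LargeRect.exists_avoid {Z : Set (ℕ × ℕ)} (h : LargeRect Z) (R : Set (Finset ℕ × ℕ)) :
    ∃ Z' ⊆ Z, LargeRect Z' ∧ ∀ D : Ultrafilter (ℕ × ℕ), (∀ W ∈ D, LargeRect W) → Z' ∈ D →
      ¬ FinitaryWitness R (proj₂ D) (proj₁ D) := by
  by_cases hcase : ∃ Z' ⊆ Z, LargeRect Z' ∧
      Disjoint (finitaryMap R (Prod.fst '' Z')) (Prod.snd '' Z')
  · obtain ⟨Z', hZ', hL, hdisj⟩ := hcase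
    refine ⟨Z', hZ', hL, fun D _ hD hR => ?_⟩
    have h₁ := hR.1 _ (Filter.image_mem_map (m := Prod.fst) hD)
    have h₂ : Prod.snd '' Z' ∈ proj₂ D := Filter.image_mem_map (m := Prod.snd) hD
    obtain ⟨x, hx, hx'⟩ := (proj₂ D).nonempty_of_mem (Filter.inter_mem h₁ h₂)
    exact Set.disjoint_left.1 hdisj hx hx'
  · push Not at hcase
    obtain ⟨Z₀, hZ₀, Z₁, hZ₁, hL, hdisj, hX⟩ := h.exists_split
    refine ⟨Z₀, hZ₀, hL, fun D hDL hD hR => ?_⟩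
    obtain ⟨X, hXD, hsub⟩ := hR.2 _ (Filter.image_mem_map (m := Prod.snd) hD)
    refine hcase _ (Set.inter_subset_left.trans hZ₁) (hX X (hDL _ (Filter.inter_mem hD hXD))) ?_
    refine (hdisj.mono_left ?_).mono_right (Set.image_mono Set.inter_subset_left)
    refine (finitaryMap_mono R ?_).trans hsub
    rintro _ ⟨q, hq, rfl⟩
    exact hq.2

theorem LargeRect.exists_avoid_swap {Z : Set (ℕ × ℕ)} (h : LargeRect Z)
    (R : Set (Finset ℕ × ℕ)) :
    ∃ Z' ⊆ Z, LargeRect Z' ∧ ∀ D : Ultrafilter (ℕ × ℕ), (∀ W ∈ D, LargeRect W) → Z' ∈ D →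
      ¬ FinitaryWitness R (proj₁ D) (proj₂ D) := by
  obtain ⟨Z', hZ', hL, hD⟩ := h.swap.exists_avoid R
  exact ⟨Prod.swap ⁻¹' Z', fun q hq => hZ' hq, hL.swap, fun D hDL hmem =>
    hD (D.map Prod.swap) (fun W hW => (hDL _ hW).swap) hmem⟩

/-! ### Pseudo-intersections from Martin's Axiom -/

/-- The conditions for adding a pseudo-intersection of `𝓕`: a finite part of the generic set,
and a finite part of `𝓕` to which all new points have to belong. -/
@[ext]
structure MathiasCond {β : Type} (𝓕 : Set (Set β)) where
  stem : Finset β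
  side : Finset 𝓕

namespace MathiasCond

variable {β : Type} {𝓕 : Set (Set β)}

instance : PartialOrder (MathiasCond 𝓕) where
  le q p := p.stem ⊆ q.stem ∧ p.side ⊆ q.side ∧ ∀ x ∈ q.stem, x ∉ p.stem → ∀ F ∈ p.side, x ∈ F.1
  le_refl p := ⟨subset_rfl, subset_rfl, fun _ h h' => absurd h h'⟩
  le_trans r q p hrq hqp := by
    refine ⟨hqp.1.trans hrq.1, hqp.2.1.trans hrq.2.1, fun x hx hxp F hF => ?_⟩
    by_cases hxq : x ∈ q.stem
    · exact hqp.2.2 x hxq hxp F hF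
    · exact hrq.2.2 x hx hxq F (hqp.2.1 hF)
  le_antisymm p q hpq hqp :=
    MathiasCond.ext (hqp.1.antisymm hpq.1) (hqp.2.1.antisymm hpq.2.1)

/-- Conditions with equal stems are compatible, and there are only countably many stems. -/
theorem ccc [Countable β] : CCC (MathiasCond 𝓕) := by
  intro A hA
  refine Set.MapsTo.countable_of_injOn (f := stem) (t := Set.univ) (fun _ _ => Set.mem_univ _) ?_
    Set.countable_univ
  intro p hp q hq hpq
  by_contra hne
  classical
  refine hA hp hq hne ⟨⟨p.stem, p.side ∪ q.side⟩, ?_, ?_⟩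
  · exact ⟨subset_rfl, Finset.subset_union_left, fun x hx hx' => absurd hx hx'⟩
  · exact ⟨hpq.ge, Finset.subset_union_right, fun x hx hx' => absurd (hpq ▸ hx) hx'⟩

end MathiasCond

/-- The pseudo-intersection is the union of the stems in a filter. Meeting `A F` makes it almost
contained in `F`; meeting every `B k` makes it large. Density of `B k` is where largeness of finite
intersections enters. -/
theorem MartinsAxiom.exists_pseudoIntersection (hMA : MartinsAxiom) (𝓕 : Set (Set (ℕ × ℕ)))
    (hcard : #𝓕 < 𝔠)
    (hfip : ∀ t : Finset (Set (ℕ × ℕ)), (t : Set (Set (ℕ × ℕ))) ⊆ 𝓕 → LargeRect (⋂₀ t)) :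
    ∃ Z, LargeRect Z ∧ ∀ F ∈ 𝓕, (Z \ F).Finite := by
  classical
  let P := MathiasCond 𝓕
  let A : 𝓕 → Set P := fun F => {p | F ∈ p.side}
  let B : ℕ → Set P := fun k => {p | ∃ n, k ≤ n ∧ HasRect k n p.stem}
  have : Nonempty P := ⟨⟨∅, ∅⟩⟩
  have hlt : #(Set.range A ∪ Set.range B : Set (Set P)) < 𝔠 := by
    refine (Cardinal.mk_union_le _ _).trans_lt (Cardinal.add_lt_of_lt Cardinal.aleph0_le_continuum
      (Cardinal.mk_range_le.trans_lt hcard) ?_)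
    exact ((Cardinal.mk_range_le (f := B)).trans_lt (by simpa using Cardinal.aleph0_lt_continuum))
  have hdense : ∀ S ∈ (Set.range A ∪ Set.range B : Set (Set P)), DenseSet S := by
    rintro _ (⟨F, rfl⟩ | ⟨k, rfl⟩) p
    · exact ⟨⟨p.stem, insert F p.side⟩, Finset.mem_insert_self _ _, subset_rfl,
        Finset.subset_insert _ _, fun x hx hx' => absurd hx hx'⟩
    · have hL : LargeRect (⋂₀ ((p.side.image Subtype.val : Finset _) : Set (Set (ℕ × ℕ)))) := by
        refine hfip _ fun F hF => ?_
        obtain ⟨F', -, rfl⟩ := Finset.mem_image.1 (Finset.mem_coe.1 hF)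
        exact F'.2
      obtain ⟨n, hn, S, T, hS, hT, hSn, hTn, hr⟩ := hL k
      refine ⟨⟨p.stem ∪ S ×ˢ T, p.side⟩, ⟨n, hn, S, T, hS, hT, hSn, hTn, fun a ha b hb => ?_⟩,
        Finset.subset_union_left, subset_rfl, fun x hx hx' F hF => ?_⟩
      · exact Finset.mem_coe.2 (Finset.mem_union_right _ (Finset.mk_mem_product ha hb))
      · obtain ⟨ha, hb⟩ := Finset.mem_product.1 ((Finset.mem_union.1 hx).resolve_left hx')
        exact hr _ ha _ hb F.1 (Finset.mem_coe.2 (Finset.mem_image_of_mem _ hF))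
  obtain ⟨G, hG⟩ := hMA P MathiasCond.ccc _ hlt hdense
  refine ⟨{x | ∃ p ∈ G, x ∈ p.stem}, fun k => ?_, fun F hF => ?_⟩
  · obtain ⟨p, hp, n, hn, hr⟩ := hG _ (Or.inr ⟨k, rfl⟩)
    exact ⟨n, hn, hr.mono le_rfl fun x hx => ⟨p, hp, hx⟩⟩
  · obtain ⟨p, hp, hFp⟩ := hG _ (Or.inl ⟨⟨F, hF⟩, rfl⟩)
    refine p.stem.finite_toSet.subset ?_
    rintro x ⟨⟨q, hq, hxq⟩, hxF⟩
    obtain ⟨r, -, hrp, hrq⟩ := G.directed p hp q hq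
    by_contra hxp
    exact hxF (hrp.2.2 x (hrq.1 hxq) hxp ⟨F, hF⟩ hFp)

/-- Among finitely many members of a chain under almost inclusion, one is almost contained in
the intersection. -/
theorem exists_diff_sInter_finite {β : Type*} (t : Finset (Set β)) (ht : t.Nonempty)
    (hchain : ∀ A ∈ t, ∀ B ∈ t, (A \ B).Finite ∨ (B \ A).Finite) :
    ∃ A ∈ t, (A \ ⋂₀ t).Finite := by
  classical
  induction ht using Finset.Nonempty.cons_induction with
  | singleton A => exact ⟨A, by simp, by simp⟩
  | cons A t hA _ ih =>
    obtain ⟨B, hB, hfin⟩ := ih fun C hC E hE =>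
      hchain C (Finset.mem_cons_of_mem hC) E (Finset.mem_cons_of_mem hE)
    rw [Finset.coe_cons, Set.sInter_insert]
    rcases hchain A (Finset.mem_cons_self _ _) B (Finset.mem_cons_of_mem hB) with h | h
    · refine ⟨A, Finset.mem_cons_self _ _, (h.union hfin).subset ?_⟩
      rintro x ⟨hx, hx'⟩
      by_cases hxB : x ∈ B
      · exact Or.inr ⟨hxB, fun hxt => hx' ⟨hx, hxt⟩⟩
      · exact Or.inl ⟨hx, hxB⟩
    · refine ⟨B, Finset.mem_cons_of_mem hB, (h.union hfin).subset ?_⟩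
      rintro x ⟨hx, hx'⟩
      by_cases hxA : x ∈ A
      · exact Or.inr ⟨hx, fun hxt => hx' ⟨hxA, hxt⟩⟩
      · exact Or.inl ⟨hx, hxA⟩

theorem MartinsAxiom.exists_pseudoIntersection_of_chain (hMA : MartinsAxiom)
    (𝓕 : Set (Set (ℕ × ℕ))) (hcard : #𝓕 < 𝔠) (hL : ∀ A ∈ 𝓕, LargeRect A)
    (hchain : ∀ A ∈ 𝓕, ∀ B ∈ 𝓕, (A \ B).Finite ∨ (B \ A).Finite) :
    ∃ Z, LargeRect Z ∧ ∀ F ∈ 𝓕, (Z \ F).Finite := by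
  refine hMA.exists_pseudoIntersection 𝓕 hcard fun t ht => ?_
  rcases t.eq_empty_or_nonempty with rfl | hne
  · simpa using largeRect_univ
  · obtain ⟨A, hA, hfin⟩ := exists_diff_sInter_finite t hne
      fun A hA B hB => hchain A (ht hA) B (ht hB)
    refine ((hL A (ht hA)).diff_finite hfin).mono ?_
    rintro x ⟨hx, hx'⟩
    by_contra hxt
    exact hx' ⟨hx, hxt⟩

/-! ### The generic tower -/

/-- Under Martin's Axiom there is a tower of large sets that meets continuum many dense
requirements. -/
theorem MartinsAxiom.exists_tower (hMA : MartinsAxiom) {ι : Type} (hι : #ι = 𝔠)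
    (Q : ι → Set (ℕ × ℕ) → Prop)
    (hQ : ∀ i Z, LargeRect Z → ∃ Z' ⊆ Z, LargeRect Z' ∧ Q i Z') :
    ∃ Z : ι → Set (ℕ × ℕ), (∀ i, LargeRect (Z i) ∧ Q i (Z i)) ∧
      ∀ i j, (Z i \ Z j).Finite ∨ (Z j \ Z i).Finite := by
  have hmk : #(Cardinal.ord 𝔠).ToType = #ι := by rw [hι]; simp
  obtain ⟨e⟩ := Cardinal.eq.1 hmk
  let C : ∀ i : (Cardinal.ord 𝔠).ToType, (∀ j, j < i → Set (ℕ × ℕ)) → Set (ℕ × ℕ) → Prop := fun i ih W =>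
    LargeRect W ∧ Q (e i) W ∧ ∀ j (h : j < i), (W \ ih j h).Finite
  -- Choosing by `epsilon` defines the tower before its stages are known to be satisfiable; `key`
  -- proves that by induction, each stage having fewer than `𝔠` predecessors.
  let Z : (Cardinal.ord 𝔠).ToType → Set (ℕ × ℕ) :=
    WellFounded.fix (wellFounded_lt) fun i ih => Classical.epsilon (C i ih)
  have hZ : ∀ i, Z i = Classical.epsilon (C i fun j _ => Z j) := fun i => WellFounded.fix_eq _ _ i
  have key : ∀ i, C i (fun j _ => Z j) (Z i) := by
    intro i
    induction i using WellFoundedLT.induction with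
    | ind i ih =>
    rw [hZ i]
    apply Classical.epsilon_spec (p := C i fun j _ => Z j)
    obtain ⟨W, hW, hfin⟩ := hMA.exists_pseudoIntersection_of_chain (Z '' Set.Iio i)
      (Cardinal.mk_image_le.trans_lt ((Cardinal.mk_Iio_lt i (by simp)).trans_eq (by simp)))
      (by rintro _ ⟨j, hj, rfl⟩; exact (ih j hj).1)
      (by
        rintro _ ⟨j, hj, rfl⟩ _ ⟨k, hk, rfl⟩
        rcases lt_trichotomy j k with h | rfl | h
        · exact Or.inr ((ih k hk).2.2 j h)
        · simp
        · exact Or.inl ((ih j hj).2.2 k h))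
    obtain ⟨W', hW', hL, hQW⟩ := hQ (e i) W hW
    exact ⟨W', hL, hQW, fun j hj =>
      (hfin _ ⟨j, hj, rfl⟩).subset (Set.sdiff_subset_sdiff_left hW')⟩
  refine ⟨Z ∘ e.symm, fun i => ⟨(key _).1, by simpa using (key (e.symm i)).2.1⟩, fun i j => ?_⟩
  rcases lt_trichotomy (e.symm i) (e.symm j) with h | h | h
  · exact Or.inr ((key _).2.2 _ h)
  · simp [h]
  · exact Or.inl ((key _).2.2 _ h)

/-- Shrinking a large set so as to decide a sequence of sets. -/
theorem MartinsAxiom.exists_decide (hMA : MartinsAxiom) {Z : Set (ℕ × ℕ)} (h : LargeRect Z)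
    (W : ℕ → Set (ℕ × ℕ)) :
    ∃ Z' ⊆ Z, LargeRect Z' ∧
      ((∀ n, (Z' \ W n).Finite) ∨ ∃ n, Z' ∩ ⋂ m ≤ n, W m = ∅) := by
  -- If every finite intersection stays large on `Z`, take a pseudo-intersection of them; otherwise
  -- remove the first kind of obstruction, a finite intersection that is small on `Z`.
  by_cases hcase : ∀ n, LargeRect (Z ∩ ⋂ m ≤ n, W m)
  · have hanti : Antitone fun n => Z ∩ ⋂ m ≤ n, W m := fun n k hnk =>
      Set.inter_subset_inter_right _ (Set.biInter_subset_biInter_left fun m hm => le_trans hm hnk)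
    obtain ⟨Y, hY, hfin⟩ := hMA.exists_pseudoIntersection_of_chain
      (Set.range fun n => Z ∩ ⋂ m ≤ n, W m)
      (Cardinal.mk_range_le.trans_lt (by simpa using Cardinal.aleph0_lt_continuum))
      (by rintro _ ⟨n, rfl⟩; exact hcase n)
      (by
        rintro _ ⟨n, rfl⟩ _ ⟨k, rfl⟩
        rcases le_total n k with hnk | hnk
        · right; rw [Set.sdiff_eq_empty.2 (hanti hnk)]; exact Set.finite_empty
        · left; rw [Set.sdiff_eq_empty.2 (hanti hnk)]; exact Set.finite_empty)
    refine ⟨Y ∩ Z, Set.inter_subset_right, ?_, Or.inl fun n => ?_⟩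
    · refine (hY.diff_finite (hfin _ ⟨0, rfl⟩)).mono ?_
      rintro x ⟨hx, hx'⟩
      refine ⟨hx, ?_⟩
      by_contra hxZ
      exact hx' ⟨hx, fun hmem => hxZ hmem.1⟩
    · refine (hfin _ ⟨n, rfl⟩).subset ?_
      rintro x ⟨⟨hx, -⟩, hxW⟩
      exact ⟨hx, fun hmem => hxW (Set.mem_iInter₂.1 hmem.2 n le_rfl)⟩
  · push Not at hcase
    obtain ⟨n, hn⟩ := hcase
    refine ⟨Z \ ⋂ m ≤ n, W m, Set.sdiff_subset, (h.inter_or_diff _).resolve_left hn,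
      Or.inr ⟨n, by simp⟩⟩

/-- The generic p-point: all its members are large, and it avoids all finitary reductions between
its two projections. -/
theorem MartinsAxiom.exists_ppoint (hMA : MartinsAxiom) :
    ∃ D : Ultrafilter (ℕ × ℕ), IsPPoint D ∧ (∀ W ∈ D, LargeRect W) ∧
      (∀ R, ¬ FinitaryWitness R (proj₂ D) (proj₁ D)) ∧
      ∀ R, ¬ FinitaryWitness R (proj₁ D) (proj₂ D) := by
  -- An index pairs a sequence to decide with a relation to defeat.
  let ι := (ℕ → Set (ℕ × ℕ)) × Set (Finset ℕ × ℕ)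
  have hι : #ι = 𝔠 := by simp [ι]
  let Q : ι → Set (ℕ × ℕ) → Prop := fun i Z =>
    ((∀ n, (Z \ i.1 n).Finite) ∨ ∃ n, Z ∩ ⋂ m ≤ n, i.1 m = ∅) ∧
    ∀ D : Ultrafilter (ℕ × ℕ), (∀ W ∈ D, LargeRect W) → Z ∈ D →
      ¬ FinitaryWitness i.2 (proj₂ D) (proj₁ D) ∧ ¬ FinitaryWitness i.2 (proj₁ D) (proj₂ D)
  obtain ⟨Z, hZ, hchain⟩ := hMA.exists_tower hι Q (by
    intro i Z hZ
    obtain ⟨Z₁, h₁, hL₁, hD₁⟩ := hZ.exists_avoid i.2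
    obtain ⟨Z₂, h₂, hL₂, hD₂⟩ := hL₁.exists_avoid_swap i.2
    obtain ⟨Z₃, h₃, hL₃, hdec⟩ := hMA.exists_decide hL₂ i.1
    refine ⟨Z₃, h₃.trans (h₂.trans h₁), hL₃, hdec, fun D hDL hD => ⟨hD₁ D hDL ?_, hD₂ D hDL ?_⟩⟩
    · exact Filter.mem_of_superset hD (h₃.trans h₂)
    · exact Filter.mem_of_superset hD h₃)
  let F : Filter (ℕ × ℕ) :=
    { sets := {W | ∃ i, (Z i \ W).Finite}
      univ_sets := ⟨(fun _ => ∅, ∅), by simp⟩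
      sets_of_superset := fun ⟨i, hi⟩ hVW => ⟨i, hi.subset (Set.sdiff_subset_sdiff_right hVW)⟩
      inter_sets := by
        rintro V W ⟨i, hi⟩ ⟨j, hj⟩
        rcases hchain i j with h | h
        · refine ⟨i, (hi.union (h.union hj)).subset ?_⟩
          rintro x ⟨hx, hx'⟩
          simp only [Set.mem_inter_iff, Set.mem_union, Set.mem_sdiff] at *
          tauto
        · refine ⟨j, (hj.union (h.union hi)).subset ?_⟩
          rintro x ⟨hx, hx'⟩
          simp only [Set.mem_inter_iff, Set.mem_union, Set.mem_sdiff] at *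
          tauto }
  have hFL : ∀ W ∈ F, LargeRect W := by
    rintro W ⟨i, hi⟩
    refine ((hZ i).1.diff_finite hi).mono ?_
    rintro x ⟨hx, hx'⟩
    by_contra hxW
    exact hx' ⟨hx, hxW⟩
  have hdec : ∀ W : ℕ → Set (ℕ × ℕ), (∃ Y ∈ F, ∀ n, (Y \ W n).Finite) ∨
      ∃ n, (⋂ m ≤ n, W m)ᶜ ∈ F := by
    intro W
    rcases (hZ (W, ∅)).2.1 with h | ⟨n, hn⟩
    · exact Or.inl ⟨_, ⟨(W, ∅), by simp⟩, h⟩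
    · refine Or.inr ⟨n, (W, ∅), ?_⟩
      rw [Set.sdiff_compl]
      exact hn ▸ Set.finite_empty
  have hnot : ∅ ∉ F := fun h => not_largeRect_of_bounded 0 (by simp) (hFL _ h)
  -- Deciding constant sequences already makes `F` an ultrafilter; deciding arbitrary ones makes it
  -- a p-point.
  let D : Ultrafilter (ℕ × ℕ) := Ultrafilter.ofComplNotMemIff F fun W => by
    constructor
    · intro hW
      rcases hdec fun _ => W with ⟨Y, hY, hfin⟩ | ⟨n, hn⟩
      · obtain ⟨i, hi⟩ := hY
        refine ⟨i, (hi.union (hfin 0)).subset ?_⟩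
        rintro x ⟨hx, hx'⟩
        by_cases hxY : x ∈ Y
        · exact Or.inr ⟨hxY, hx'⟩
        · exact Or.inl ⟨hx, hxY⟩
      · refine absurd (Filter.mem_of_superset hn (Set.compl_subset_compl.2 ?_)) hW
        exact Set.subset_iInter₂ fun _ _ => subset_rfl
    · exact fun hW hW' => hnot (by simpa using Filter.inter_mem hW hW')
  have hDL : ∀ W ∈ D, LargeRect W := hFL
  have hZD : ∀ i, Z i ∈ D := fun i => ⟨i, by simp⟩
  refine ⟨D, ⟨fun a ha => ?_, fun X hX => ?_⟩, hDL,
    fun R => (((hZ (fun _ => ∅, R)).2.2 D hDL (hZD _)).1),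
    fun R => (((hZ (fun _ => ∅, R)).2.2 D hDL (hZD _)).2)⟩
  · refine not_largeRect_of_bounded (a.1.unpair.1 + 1) ?_ (hDL _ ha)
    rintro q rfl
    exact Nat.lt_succ_self _
  · refine (hdec X).resolve_right ?_
    rintro ⟨n, hn⟩
    refine (Ultrafilter.compl_mem_iff_notMem (f := D)).1 hn ?_
    exact (Filter.biInter_mem (Set.finite_Iic n)).2 fun m _ => hX m

end TukeyUF

/-! ### The diamond of Tukey types. -/

theorem theorem5p11 (hMA : TukeyUF.MartinsAxiom) :
    ∃ (D : Ultrafilter (ℕ × ℕ)) (E : Ultrafilter ℕ)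
      (hD : TukeyUF.IsPPoint D)
      (h₁ : TukeyUF.IsPPoint (TukeyUF.proj₁ D))
      (h₂ : TukeyUF.IsPPoint (TukeyUF.proj₂ D))
      (hE : TukeyUF.IsPPoint E),
      TukeyUF.TukeyIncomparable (TukeyUF.proj₁ D) (TukeyUF.proj₂ D) ∧
      TukeyUF.TukeyLT (TukeyUF.proj₁ D) D ∧
      TukeyUF.TukeyLT (TukeyUF.proj₂ D) D ∧
      TukeyUF.TukeyLT E (TukeyUF.proj₁ D) ∧
      TukeyUF.TukeyLT E (TukeyUF.proj₂ D) ∧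
      ∃ φ : Bool × Bool ↪o TukeyUF.PPointType,
        φ (true, true) = TukeyUF.tukeyType (D.map Nat.pairEquiv) (hD.mapEquiv Nat.pairEquiv) ∧
        φ (true, false) = TukeyUF.tukeyType (TukeyUF.proj₁ D) h₁ ∧
        φ (false, true) = TukeyUF.tukeyType (TukeyUF.proj₂ D) h₂ ∧
        φ (false, false) = TukeyUF.tukeyType E hE := by
  open TukeyUF in
  obtain ⟨D, hD, hDL, hR₁, hR₂⟩ := hMA.exists_ppoint
  -- The complement contains not even a `1 × 1` rectangle within a block, so it is not large.
  have hdiag : {q : ℕ × ℕ | q.1.unpair.1 = q.2.unpair.1} ∈ D := by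
    by_contra hnot
    obtain ⟨n, -, S, T, hS, hT, hSn, hTn, hr⟩ := hDL _ (Ultrafilter.compl_mem_iff_notMem.2 hnot) 1
    obtain ⟨a, ha⟩ := Finset.card_pos.1 (hS ▸ Nat.one_pos)
    obtain ⟨b, hb⟩ := Finset.card_pos.1 (hT ▸ Nat.one_pos)
    exact hr a ha b hb ((hSn a ha).trans (hTn b hb).symm)
  let E : Ultrafilter ℕ := (proj₁ D).map fun a => a.unpair.1
  have hE₂ : E = (proj₂ D).map fun a => a.unpair.1 := by
    simp only [E, proj₁, proj₂, Ultrafilter.map_map]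
    exact Ultrafilter.coe_injective (Filter.map_congr hdiag)
  have hEne : ∀ b, ({b} : Set ℕ) ∉ E := by
    intro b hb
    refine not_largeRect_of_bounded (b + 1) ?_ (hDL _ hb)
    rintro q hq
    exact Nat.lt_succ_of_le (le_of_eq hq)
  have hsing : ∀ (V : Ultrafilter ℕ), E = V.map (fun a => a.unpair.1) → ∀ b, ({b} : Set ℕ) ∉ V := by
    intro V hV b hb
    refine hEne b.unpair.1 (hV ▸ ?_)
    change (fun a : ℕ => a.unpair.1) ⁻¹' {b.unpair.1} ∈ V
    exact Filter.mem_of_superset hb (by simp)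
  have h₁ : IsPPoint (proj₁ D) := hD.map _ (hsing _ rfl)
  have h₂ : IsPPoint (proj₂ D) := hD.map _ (hsing _ hE₂)
  have hE : IsPPoint E := h₁.map _ hEne
  have hn₁₂ : ¬ TukeyLE (proj₁ D) (proj₂ D) := fun h =>
    let ⟨R, hR⟩ := h₂.exists_finitaryWitness h; hR₂ R hR
  have hn₂₁ : ¬ TukeyLE (proj₂ D) (proj₁ D) := fun h =>
    let ⟨R, hR⟩ := h₁.exists_finitaryWitness h; hR₁ R hR
  have l₁ : TukeyLE (proj₁ D) D := TukeyLE.map _ _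
  have l₂ : TukeyLE (proj₂ D) D := TukeyLE.map _ _
  have e₁ : TukeyLE E (proj₁ D) := TukeyLE.map _ _
  have e₂ : TukeyLE E (proj₂ D) := hE₂ ▸ TukeyLE.map _ _
  -- A reduction of `D` to one projection, or of one projection to `E`, would make the projections
  -- comparable.
  have nD₁ : ¬ TukeyLE D (proj₁ D) := fun h => hn₂₁ (l₂.trans h)
  have nD₂ : ¬ TukeyLE D (proj₂ D) := fun h => hn₁₂ (l₁.trans h)
  have nE₁ : ¬ TukeyLE (proj₁ D) E := fun h => hn₁₂ (h.trans e₂)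
  have nE₂ : ¬ TukeyLE (proj₂ D) E := fun h => hn₂₁ (h.trans e₁)
  have nDE : ¬ TukeyLE D E := fun h => nE₁ (l₁.trans h)
  have dge : TukeyLE D (D.map Nat.pairEquiv) := by
    have h := TukeyLE.map (D.map Nat.pairEquiv) Nat.pairEquiv.symm
    rwa [Ultrafilter.map_map, Equiv.symm_comp_self, Ultrafilter.map_id] at h
  refine ⟨D, E, hD, h₁, h₂, hE, ⟨hn₁₂, hn₂₁⟩, ⟨l₁, nD₁⟩, ⟨l₂, nD₂⟩, ⟨e₁, nE₁⟩, ⟨e₂, nE₂⟩, ?_⟩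
  let g : Bool × Bool → PPoint := fun q => match q with
    | (true, true) => ⟨_, hD.mapEquiv Nat.pairEquiv⟩
    | (true, false) => ⟨_, h₁⟩
    | (false, true) => ⟨_, h₂⟩
    | (false, false) => ⟨E, hE⟩
  have hg : ∀ a b, g a ≤ g b ↔ a ≤ b := by
    rintro ⟨_ | _, _ | _⟩ ⟨_ | _, _ | _⟩
    · exact iff_of_true (TukeyLE.refl _) (by decide)
    · exact iff_of_true e₂ (by decide)
    · exact iff_of_true e₁ (by decide)
    · exact iff_of_true ((e₁.trans l₁).trans dge) (by decide)
    · exact iff_of_false nE₂ (by decide)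
    · exact iff_of_true (TukeyLE.refl _) (by decide)
    · exact iff_of_false hn₂₁ (by decide)
    · exact iff_of_true (l₂.trans dge) (by decide)
    · exact iff_of_false nE₁ (by decide)
    · exact iff_of_false hn₁₂ (by decide)
    · exact iff_of_true (TukeyLE.refl _) (by decide)
    · exact iff_of_true (l₁.trans dge) (by decide)
    · exact iff_of_false (fun h => nDE (dge.trans h)) (by decide)
    · exact iff_of_false (fun h => nD₂ (dge.trans h)) (by decide)
    · exact iff_of_false (fun h => nD₁ (dge.trans h)) (by decide)
    · exact iff_of_true (TukeyLE.refl _) (by decide)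
  exact ⟨OrderEmbedding.ofMapLEIff (fun q => toAntisymmetrization (· ≤ ·) (g q)) fun a b =>
    toAntisymmetrization_le_toAntisymmetrization_iff.trans (hg a b), rfl, rfl, rfl, rfl⟩
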